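/- Let $g:\mathbb{R}^n\to\mathbb{R}$ be a Fréchet differentiable function that is bounded from below and whose gradient is $L_g$-Lipschitz continuous, where $\mathbb{R}^n$ carries the Euclidean norm. Let $t_0>0$, $\lambda,\gamma>0$, $u_0,v_0\in\mathbb{R}^n$, and let $x:[t_0,+\infty)\to\mathbb{R}^n$ be the strong global solution of $$\frac{\lambda}{t^2}\ddot{x}(t)+\frac{\gamma}{t}\dot{x}(t)+\nabla g(x(t))=0,\qquad x(t_0)=u_0,\ \dot{x}(t_0)=v_0,\tag{DS}$$ that is, $x,\dot x,\ddot x$ are defined on $[t_0,+\infty)$ and absolutely continuous on $[t_0,b]$ for every $b>t_0$, the differential equation holds for almost every $t\ge t_0$, and the initial conditions hold. Let $$H:\mathbb{R}^n\times\mathbb{R}^n\to\mathbb{R},\qquad H(x,y)=g(x)+\tfrac12\|x-y\|^2.$$ For $\eta\in(0,+\infty]$ let $\Theta_\eta$ be the class of concave and continuous functions $\varphi:[0,\eta)\to[0,+\infty)$ with $\varphi(0)=0$ that are continuously differentiable on $(0,\eta)$ with $\varphi'(s)>0$ for all $s\in(0,\eta)$. A differentiable function $f:\mathbb{R}^m\to\mathbb{R}$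 is called a KL function if for every $\overline z\in\mathbb{R}^m$ there exist $\eta\in(0,+\infty]$, a neighborhood $U$ of $\overline z$ and $\varphi\in\Theta_\eta$ such that $$\varphi'(f(z)-f(\overline z))\,\|\nabla f(z)\|\ge 1\quad\text{for all } z\in U \text{ with } f(\overline z)<f(z)<f(\overline z)+\eta.$$ Suppose that $x$ is bounded on $[t_0,+\infty)$ and that $H$ is a KL function. Then: (a) $\dot{x}\in L^1([t_0,+\infty),\mathbb{R}^n)$; (b) $\frac1t\ddot{x}(t)\in L^1([t_0,+\infty),\mathbb{R}^n)$; (c) there exists $\overline{x}\in\mathbb{R}^n$ with $\nabla g(\overline x)=0$ such that $\lim_{t\to+\infty}x(t)=\overline{x}$. -/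

import Mathlib

open Set Filter Topology MeasureTheory

/-- The class of desingularizing functions for `η ∈ (0, +∞]`: concave continuous functions
`φ : [0, η) → [0, +∞)` with `φ 0 = 0` which are continuously differentiable on `(0, η)` with
`φ' > 0` there. Such a function is represented by any extension of it to `ℝ`. -/
structure IsDesingularizing (η : EReal) (φ : ℝ → ℝ) : Prop where
  nonneg : ∀ s : ℝ, 0 ≤ s → (s : EReal) < η → 0 ≤ φ s
  concaveOn : ConcaveOn ℝ {s : ℝ | 0 ≤ s ∧ (s : EReal) < η} φ
  continuousOn : ContinuousOn φ {s : ℝ | 0 ≤ s ∧ (s : EReal) < η}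
  map_zero : φ 0 = 0
  contDiffOn : ContDiffOn ℝ 1 φ {s : ℝ | 0 < s ∧ (s : EReal) < η}
  deriv_pos : ∀ s : ℝ, 0 < s → (s : EReal) < η → 0 < deriv φ s

/-- The Kurdyka-Łojasiewicz property of a (differentiable) function `f` at the point `xbar`. -/
def HasKLPropertyAt {E : Type*} [NormedAddCommGroup E] [InnerProductSpace ℝ E] [CompleteSpace E]
    (f : E → ℝ) (xbar : E) : Prop :=
  ∃ η : EReal, 0 < η ∧ ∃ U ∈ 𝓝 xbar, ∃ φ : ℝ → ℝ, IsDesingularizing η φ ∧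
    ∀ x ∈ U, f xbar < f x → (f x : EReal) < (f xbar : EReal) + η →
      1 ≤ deriv φ (f x - f xbar) * ‖gradient f x‖

/-- A KL function: a differentiable function with the Kurdyka-Łojasiewicz property at each
point. -/
def IsKLFunction {E : Type*} [NormedAddCommGroup E] [InnerProductSpace ℝ E] [CompleteSpace E]
    (f : E → ℝ) : Prop :=
  Differentiable ℝ f ∧ ∀ xbar : E, HasKLPropertyAt f xbar

/-- The set of critical points of a differentiable function `g`. -/
def crit {E : Type*} [NormedAddCommGroup E] [InnerProductSpace ℝ E] [CompleteSpace E]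
    (g : E → ℝ) : Set E :=
  {x | gradient g x = 0}

/-- The regularization `H(x, y) = g(x) + ½‖x - y‖²` of `g`, on the product space with its
Euclidean norm. -/
noncomputable def regularization {E : Type*} [NormedAddCommGroup E] (g : E → ℝ) :
    WithLp 2 (E × E) → ℝ :=
  fun z => g z.fst + 1 / 2 * ‖z.fst - z.snd‖ ^ 2

/-- The derivative of a curve `x : [t₀, +∞) → E`, one-sided at `t₀`; the values of `x` to the
left of `t₀` do not matter for its values on `[t₀, +∞)`. -/
noncomputable def curveDeriv {E : Type*} [NormedAddCommGroup E] [NormedSpace ℝ E] (t₀ : ℝ)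
    (x : ℝ → E) : ℝ → E :=
  derivWithin x (Ici t₀)

/-- Local absolute continuity on `[t₀, +∞)`: absolute continuity on every `[t₀, b]`. -/
def LocallyAbsolutelyContinuous {E : Type*} [NormedAddCommGroup E] (t₀ : ℝ) (x : ℝ → E) : Prop :=
  ∀ b : ℝ, t₀ < b → AbsolutelyContinuousOnInterval x t₀ b

/-- `x : [t₀, +∞) → E` is a strong global solution of
`(lam / t²) x''(t) + (gam / t) x'(t) + ∇g(x(t)) = 0`, `x(t₀) = u₀`, `x'(t₀) = v₀`.
The functions `x'` and `x''` are genuine derivatives on all of `[t₀, +∞)`. -/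
structure IsStrongGlobalSolution {E : Type*} [NormedAddCommGroup E] [InnerProductSpace ℝ E]
    [CompleteSpace E] (g : E → ℝ) (lam gam t₀ : ℝ) (u₀ v₀ : E) (x : ℝ → E) : Prop where
  differentiableOn : DifferentiableOn ℝ x (Ici t₀)
  differentiableOn_deriv : DifferentiableOn ℝ (curveDeriv t₀ x) (Ici t₀)
  locAC : LocallyAbsolutelyContinuous t₀ x
  locAC_deriv : LocallyAbsolutelyContinuous t₀ (curveDeriv t₀ x)
  locAC_deriv_deriv : LocallyAbsolutelyContinuous t₀ (curveDeriv t₀ (curveDeriv t₀ x))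
  equation : ∀ᵐ t ∂(volume.restrict (Ici t₀)),
    (lam / t ^ 2) • curveDeriv t₀ (curveDeriv t₀ x) t + (gam / t) • curveDeriv t₀ x t
      + gradient g (x t) = 0
  initial_pos : x t₀ = u₀
  initial_vel : curveDeriv t₀ x t₀ = v₀

/-! Put w = x'/t. Then x' = t w and w' = t (-κ w - ∇g(x)/lam) with κ = gam/lam + 1/t², so up to the
time change s = t²/2 this is a heavy ball with bounded, uniformly positive damping
(`hasDerivAt_inv_smul_curveDeriv`).

The usual energy g(x) + lam/2 ‖w‖² dissipates only ‖w‖². Evaluating g at p = x + θ w, for small θ >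
0, adds dissipation of ‖∇g(x)‖² (`inner_add_inner_le_neg_mul_sq`). The new energy is exactly H along
z = (p, p + √lam w). With δ = ‖w‖ + ‖∇g(x)‖ and up to constants, H(z) decreases at rate at least t
δ², while ‖∇H(z)‖ ≤ δ and ‖z'‖ ≤ t δ.

These are the hypotheses of the KL finite length argument `HasKLPropertyAt.exists_integrableOn_Ioi`:
near a cluster point, φ(H(z) - H(zbar)) falls at least as fast as the integral of ρ = t δ grows, so
z stays near zbar and ρ is integrable. Since ρ = ‖x'‖ + t ‖∇g(x)‖, this gives (a), then (b) through
the equation; x converges since x' is integrable, and its limit is critical since t ‖∇g(x)‖ is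
integrable. -/

/-- The primitive `t ↦ ∫ₐᵗ ρ` of a function that is continuous on `(T₀, ∞)`. -/
theorem hasDerivAt_integral_of_continuousOn_Ioi {ρ : ℝ → ℝ} {T₀ T t : ℝ}
    (hρ : ContinuousOn ρ (Ioi T₀)) (hT : T₀ < T) (ht : T₀ < t) :
    HasDerivAt (fun s => ∫ u in T..s, ρ u) (ρ t) t := by
  have hcont : ContinuousOn ρ (uIcc T t) :=
    hρ.mono fun u hu => lt_of_lt_of_le (lt_min hT ht) hu.1
  exact intervalIntegral.integral_hasDerivAt_right hcont.intervalIntegrable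
    (hρ.stronglyMeasurableAtFilter isOpen_Ioi t ht) (hρ.continuousAt (Ioi_mem_nhds ht))

theorem integrableOn_Ioi_of_integral_le {ρ : ℝ → ℝ} {T₀ T M : ℝ}
    (hρ : ContinuousOn ρ (Ioi T₀)) (hρ0 : ∀ t, T₀ < t → 0 ≤ ρ t) (hT : T₀ < T)
    (hM : ∀ t, T ≤ t → ∫ u in T..t, ρ u ≤ M) : IntegrableOn ρ (Ioi T) := by
  refine integrableOn_Ioi_of_intervalIntegral_norm_bounded (l := atTop) (b := id) M T
    (fun i => ?_) tendsto_id ?_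
  · exact ((hρ.mono fun u hu => lt_of_lt_of_le hT hu.1).integrableOn_Icc
      (a := T) (b := i)).mono_set Ioc_subset_Icc_self
  · filter_upwards [eventually_ge_atTop T] with t ht
    rw [intervalIntegral.integral_congr (g := ρ)]
    · exact hM t ht
    · intro u hu
      rw [id_eq, uIcc_of_le ht] at hu
      exact Real.norm_of_nonneg (hρ0 u (lt_of_lt_of_le hT hu.1))

/-! ### Desingularizing functions -/

theorem IsDesingularizing.differentiableAt {η : EReal} {φ : ℝ → ℝ} (hφ : IsDesingularizing η φ)
    {s : ℝ} (hs : 0 < s) (hsη : (s : EReal) < η) : DifferentiableAt ℝ φ s := by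
  have hopen : IsOpen {s : ℝ | 0 < s ∧ (s : EReal) < η} :=
    isOpen_Ioi.inter (isOpen_Iio.preimage continuous_coe_real_ereal)
  exact (hφ.contDiffOn.differentiableOn one_ne_zero).differentiableAt
    (hopen.mem_nhds ⟨hs, hsη⟩)

theorem IsDesingularizing.tendsto_nhdsGT {η : EReal} {φ : ℝ → ℝ} (hφ : IsDesingularizing η φ)
    (hη : 0 < η) : Tendsto φ (𝓝[>] 0) (𝓝 0) := by
  have h := hφ.continuousOn 0 ⟨le_rfl, by simpa using hη⟩
  rw [ContinuousWithinAt, hφ.map_zero] at h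
  refine h.mono_left (le_inf nhdsWithin_le_nhds ?_)
  have h2 : {s : ℝ | (s : EReal) < η} ∈ 𝓝 (0 : ℝ) :=
    (isOpen_Iio.preimage continuous_coe_real_ereal).mem_nhds (by simpa using hη)
  rw [le_principal_iff]
  filter_upwards [mem_nhdsWithin_of_mem_nhds h2, self_mem_nhdsWithin] with s hs hs0
  exact ⟨le_of_lt hs0, hs⟩

/-! ### Finite length of descent curves under the KL inequality -/

section Trajectory

variable {F : Type*} [NormedAddCommGroup F] [InnerProductSpace ℝ F] [CompleteSpace F]

/-- Along a curve on which `f` decreases at rate `c * ρ * ‖∇f‖`, the integral of `ρ` is controlled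
by the desingularizing function as long as the Kurdyka-Łojasiewicz inequality holds. -/
theorem integral_le_of_desingularizing {f : F → ℝ} {z : ℝ → F} {e e' ρ : ℝ → ℝ} {T₀ T S c v : ℝ}
    {η : EReal} {φ : ℝ → ℝ} (hφ : IsDesingularizing η φ) (hT : T₀ < T) (hTS : T ≤ S)
    (hρ : ContinuousOn ρ (Ioi T₀)) (hρ0 : ∀ t, T₀ < t → 0 ≤ ρ t) (hc : 0 < c)
    (he : ∀ t, T₀ < t → HasDerivAt e (e' t) t)
    (hdec : ∀ t, T₀ < t → c * ρ t * ‖gradient f (z t)‖ ≤ -e' t)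
    (hv : ∀ t ∈ Icc T S, v < e t) (hvη : ∀ t ∈ Icc T S, ((e t - v : ℝ) : EReal) < η)
    (hKL : ∀ t ∈ Ico T S, 1 ≤ deriv φ (e t - v) * ‖gradient f (z t)‖) :
    c * ∫ u in T..S, ρ u ≤ φ (e T - v) := by
  have hd : ∀ t ∈ Icc T S, HasDerivAt (fun t => φ (e t - v) + c * ∫ u in T..t, ρ u)
      (deriv φ (e t - v) * e' t + c * ρ t) t := by
    intro t ht
    have ht0 : T₀ < t := lt_of_lt_of_le hT ht.1
    have h1 : HasDerivAt φ (deriv φ (e t - v)) (e t - v) :=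
      (hφ.differentiableAt (sub_pos.2 (hv t ht)) (hvη t ht)).hasDerivAt
    exact (h1.comp t ((he t ht0).sub_const v)).add
      ((hasDerivAt_integral_of_continuousOn_Ioi hρ hT ht0).const_mul c)
  -- The derivative is φ'·e' + cρ ≤ cρ (1 - φ'‖∇f‖) ≤ 0. Only interior times matter, so the KL
  -- inequality is not needed at S.
  have hanti : AntitoneOn (fun t => φ (e t - v) + c * ∫ u in T..t, ρ u) (Icc T S) := by
    refine antitoneOn_of_deriv_nonpos (convex_Icc T S)
      (fun t ht => (hd t ht).continuousAt.continuousWithinAt)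
      (fun t ht => (hd t (interior_subset ht)).differentiableAt.differentiableWithinAt) ?_
    intro t ht
    rw [(hd t (interior_subset ht)).deriv]
    rw [interior_Icc] at ht
    have ht' : t ∈ Icc T S := Ioo_subset_Icc_self ht
    have ht0 : T₀ < t := hT.trans ht.1
    have hp : 0 < deriv φ (e t - v) := hφ.deriv_pos _ (sub_pos.2 (hv t ht')) (hvη t ht')
    have h1 := mul_le_mul_of_nonneg_left (hdec t ht0) hp.le
    have h2 := mul_le_mul_of_nonneg_left (hKL t ⟨ht.1.le, ht.2⟩)
      (mul_nonneg hc.le (hρ0 t ht0))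
    linarith
  have h := hanti (left_mem_Icc.2 hTS) (right_mem_Icc.2 hTS) hTS
  have h0 : 0 ≤ φ (e S - v) :=
    hφ.nonneg _ (sub_pos.2 (hv S (right_mem_Icc.2 hTS))).le (hvη S (right_mem_Icc.2 hTS))
  simp only [intervalIntegral.integral_same, mul_zero, add_zero] at h
  linarith

omit [CompleteSpace F] in
-- Comparing z with the primitive of C ρ avoids integrating z', so no integrability of z' is
-- required.
theorem norm_sub_le_integral {z z' : ℝ → F} {ρ : ℝ → ℝ} {T₀ T S C : ℝ}
    (hT : T₀ < T) (hTS : T ≤ S) (hρ : ContinuousOn ρ (Ioi T₀))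
    (hz : ∀ t, T₀ < t → HasDerivAt z (z' t) t) (hz' : ∀ t, T₀ < t → ‖z' t‖ ≤ C * ρ t) :
    ‖z S - z T‖ ≤ C * ∫ u in T..S, ρ u := by
  have hd : ∀ t, T₀ < t → HasDerivAt (fun s => C * ∫ u in T..s, ρ u) (C * ρ t) t := fun t ht =>
    (hasDerivAt_integral_of_continuousOn_Ioi hρ hT ht).const_mul C
  refine image_norm_le_of_norm_deriv_right_le_deriv_boundary' (f := fun t => z t - z T)
    (f' := z') (a := T) (b := S) (B := fun s => C * ∫ u in T..s, ρ u) (B' := fun t => C * ρ t)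
    ?_ ?_ (by simp) ?_ ?_ ?_ (right_mem_Icc.2 hTS)
  · exact fun t ht => ((hz t (lt_of_lt_of_le hT ht.1)).sub_const _).continuousAt.continuousWithinAt
  · exact fun t ht => ((hz t (lt_of_lt_of_le hT ht.1)).sub_const _).hasDerivWithinAt
  · exact fun t ht => (hd t (lt_of_lt_of_le hT ht.1)).continuousAt.continuousWithinAt
  · exact fun t ht => (hd t (lt_of_lt_of_le hT ht.1)).hasDerivWithinAt
  · exact fun t ht => hz' t (lt_of_lt_of_le hT ht.1)

/-- Finite length of a descent curve near a cluster point at which the Kurdyka-Łojasiewicz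
property holds. -/
theorem HasKLPropertyAt.exists_integrableOn_Ioi {f : F → ℝ} {z z' : ℝ → F} {e' ρ : ℝ → ℝ}
    {T₀ c C : ℝ} {zbar : F} (hKL : HasKLPropertyAt f zbar) (hf : Continuous f)
    (hclus : MapClusterPt zbar atTop z)
    (hρ : ContinuousOn ρ (Ioi T₀)) (hρ0 : ∀ t, T₀ < t → 0 ≤ ρ t) (hc : 0 < c) (hC : 0 < C)
    (hz : ∀ t, T₀ < t → HasDerivAt z (z' t) t) (hz' : ∀ t, T₀ < t → ‖z' t‖ ≤ C * ρ t)
    (he : ∀ t, T₀ < t → HasDerivAt (fun s => f (z s)) (e' t) t)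
    (hdec : ∀ t, T₀ < t → c * ρ t * ‖gradient f (z t)‖ ≤ -e' t)
    (hstat : ∀ t, T₀ < t → e' t = 0 → ρ t = 0) :
    ∃ T, T₀ < T ∧ IntegrableOn ρ (Ioi T) := by
  have hanti : AntitoneOn (fun s => f (z s)) (Ioi T₀) := by
    refine antitoneOn_of_deriv_nonpos (convex_Ioi T₀)
      (fun t ht => (he t ht).continuousAt.continuousWithinAt)
      (fun t ht => (he t (interior_subset ht)).differentiableAt.differentiableWithinAt) ?_
    intro t ht
    have ht0 := interior_subset ht
    rw [(he t ht0).deriv]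
    have := hdec t ht0
    have : 0 ≤ c * ρ t * ‖gradient f (z t)‖ :=
      mul_nonneg (mul_nonneg hc.le (hρ0 t ht0)) (norm_nonneg _)
    linarith
  have hclus' : MapClusterPt (f zbar) atTop (fun s => f (z s)) :=
    hclus.continuousAt_comp hf.continuousAt
  -- A nonincreasing function never falls below one of its cluster values.
  have hge : ∀ t, T₀ < t → f zbar ≤ f (z t) := by
    intro t ht
    by_contra! hlt
    obtain ⟨s, hs1, hs2⟩ := ((hclus'.frequently (Ioi_mem_nhds hlt)).and_eventually
      (eventually_ge_atTop t)).exists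
    exact absurd (hanti ht (lt_of_lt_of_le ht hs2) hs2) (not_le.2 hs1)
  -- The KL inequality says nothing on the level f zbar. If that level is reached, f ∘ z is constant
  -- from then on and `hstat` makes ρ vanish.
  by_cases hst : ∃ t, T₀ < t ∧ f (z t) = f zbar
  · obtain ⟨T, hT, hTe⟩ := hst
    refine ⟨T, hT, ?_⟩
    have hconst : ∀ t, T ≤ t → f (z t) = f zbar := fun t ht =>
      le_antisymm ((hanti hT (lt_of_lt_of_le hT ht) ht).trans hTe.le)
        (hge t (lt_of_lt_of_le hT ht))
    refine integrableOn_zero.congr_fun (fun t (ht : T < t) => ?_) measurableSet_Ioi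
    refine (hstat t (hT.trans ht) ?_).symm
    refine (he t (hT.trans ht)).unique ((hasDerivAt_const t (f zbar)).congr_of_eventuallyEq ?_)
    filter_upwards [Ioi_mem_nhds ht] with s hs using hconst s (le_of_lt hs)
  push Not at hst
  have hgt : ∀ t, T₀ < t → f zbar < f (z t) := fun t ht =>
    lt_of_le_of_ne (hge t ht) (hst t ht).symm
  obtain ⟨η, hη, U, hU, φ, hφ, hineq⟩ := hKL
  obtain ⟨r, hr, hrU⟩ := Metric.mem_nhds_iff.1 hU
  have hφ0 := hφ.tendsto_nhdsGT hη
  -- With this threshold the remaining length C ∫ ρ is below r/2; a start within r/2 of zbar then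
  -- keeps z in the ball of radius r.
  have hsmall : ∀ᶠ s : ℝ in 𝓝[>] (0 : ℝ), (s : EReal) < η ∧ φ s < c * (r / (2 * C)) := by
    refine Eventually.and (mem_nhdsWithin_of_mem_nhds
      ((isOpen_Iio.preimage continuous_coe_real_ereal).mem_nhds (by simpa using hη))) ?_
    exact hφ0.eventually (gt_mem_nhds (by positivity))
  obtain ⟨δ, hδ, hδs⟩ := mem_nhdsGT_iff_exists_Ioo_subset.1 hsmall
  have hnear : {w : F | f w < f zbar + δ} ∩ Metric.ball zbar (r / 2) ∈ 𝓝 zbar :=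
    inter_mem (hf.continuousAt.eventually (gt_mem_nhds (lt_add_of_pos_right _ hδ)))
      (Metric.ball_mem_nhds _ (by positivity))
  obtain ⟨T, ⟨hT1, hT2⟩, hT⟩ := ((hclus.frequently hnear).and_eventually
    (eventually_gt_atTop T₀)).exists
  change f (z T) < f zbar + δ at hT1
  have hTpos : 0 < f (z T) - f zbar := sub_pos.2 (hgt T hT)
  obtain ⟨hTη, hTφ⟩ := hδs ⟨hTpos, by linarith⟩
  have hη' : ∀ t, T ≤ t → ((f (z t) - f zbar : ℝ) : EReal) < η := fun t ht =>
    lt_of_le_of_lt (EReal.coe_le_coe_iff.2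
      (sub_le_sub_right (hanti hT (lt_of_lt_of_le hT ht) ht) _)) hTη
  have hbound : ∀ S, T ≤ S → (∀ t ∈ Ico T S, z t ∈ Metric.ball zbar r) →
      c * ∫ u in T..S, ρ u ≤ φ (f (z T) - f zbar) := by
    intro S hS hball
    refine integral_le_of_desingularizing (f := f) (z := z) (e := fun s => f (z s)) hφ hT hS hρ hρ0
      hc he hdec (fun t ht => hgt t (lt_of_lt_of_le hT ht.1)) (fun t ht => hη' t ht.1) ?_
    intro t ht
    refine hineq _ (hrU (hball t ht)) (hgt t (lt_of_lt_of_le hT ht.1)) ?_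
    have h := hη' t ht.1
    rw [EReal.coe_sub] at h
    rw [add_comm]
    exact (EReal.sub_lt_iff (Or.inl (EReal.coe_ne_bot _)) (Or.inl (EReal.coe_ne_top _))).1 h
  have hcontz : ContinuousOn z (Ici T) := fun t ht =>
    (hz t (lt_of_lt_of_le hT ht)).continuousAt.continuousWithinAt
  have htrap : ∀ t, T ≤ t → z t ∈ Metric.ball zbar r := by
    by_contra! hex
    obtain ⟨t₁, ht₁, hz₁⟩ := hex
    set A : Set ℝ := Ici T ∩ z ⁻¹' (Metric.ball zbar r)ᶜ with hA
    have hAc : IsClosed A :=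
      hcontz.preimage_isClosed_of_isClosed isClosed_Ici Metric.isOpen_ball.isClosed_compl
    have hAne : A.Nonempty := ⟨t₁, ht₁, hz₁⟩
    have hAb : BddBelow A := ⟨T, fun s hs => hs.1⟩
    have hSA : sInf A ∈ A := hAc.csInf_mem hAne hAb
    have hST : T ≤ sInf A := hSA.1
    -- sInf A is the first exit time: z is outside the ball there, so `hbound` asks for the ball
    -- only on the half-open interval.
    have hb := hbound (sInf A) hST fun t ht => by
      by_contra hcon
      exact absurd (csInf_le hAb ⟨ht.1, hcon⟩) (not_le.2 ht.2)
    have hlen := norm_sub_le_integral hT hST hρ hz hz'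
    have hint : ∫ u in T..sInf A, ρ u < r / (2 * C) := by
      by_contra! hcon
      have := mul_le_mul_of_nonneg_left hcon hc.le
      linarith
    have hlt : C * ∫ u in T..sInf A, ρ u < r / 2 := by
      have := mul_lt_mul_of_pos_left hint hC
      have h2 : C * (r / (2 * C)) = r / 2 := by field_simp
      linarith
    apply hSA.2
    rw [Metric.mem_ball] at hT2 ⊢
    have := dist_triangle (z (sInf A)) (z T) zbar
    rw [dist_eq_norm (z (sInf A)) (z T)] at this
    linarith
  refine ⟨T, hT, integrableOn_Ioi_of_integral_le (M := φ (f (z T) - f zbar) / c) hρ hρ0 hT ?_⟩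
  intro t ht
  rw [le_div_iff₀' hc]
  exact hbound t ht fun s hs => htrap s hs.1

end Trajectory

/-! ### The gradient of the regularization -/

theorem norm_toLp_two_le_add {E F : Type*} [NormedAddCommGroup E] [NormedAddCommGroup F]
    (a : E) (b : F) : ‖WithLp.toLp 2 (a, b)‖ ≤ ‖a‖ + ‖b‖ := by
  have h : WithLp.toLp 2 (a, b) = WithLp.toLp 2 (a, (0 : F)) + WithLp.toLp 2 ((0 : E), b) := by
    rw [← WithLp.toLp_add]; simp
  rw [h]
  refine (norm_add_le _ _).trans ?_
  rw [WithLp.norm_toLp_fst, WithLp.norm_toLp_snd]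

section Regularization

variable {E : Type*} [NormedAddCommGroup E] [InnerProductSpace ℝ E] [CompleteSpace E]

theorem hasGradientAt_regularization {g : E → ℝ} {z : WithLp 2 (E × E)} {G : E}
    (hg : HasGradientAt g G z.fst) :
    HasGradientAt (regularization g)
      (WithLp.toLp 2 (G + (z.fst - z.snd), z.snd - z.fst)) z := by
  have hfst : HasFDerivAt (fun w : WithLp 2 (E × E) => w.fst) (WithLp.fstL 2 ℝ E E) z :=
    (WithLp.fstL 2 ℝ E E).hasFDerivAt
  have hsnd : HasFDerivAt (fun w : WithLp 2 (E × E) => w.snd) (WithLp.sndL 2 ℝ E E) z :=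
    (WithLp.sndL 2 ℝ E E).hasFDerivAt
  have h1 : HasFDerivAt g (InnerProductSpace.toDual ℝ E G) z.fst := hg.hasFDerivAt
  have h := (h1.comp z hfst).add (((hfst.sub hsnd).norm_sq).const_mul (1 / 2 : ℝ))
  rw [hasGradientAt_iff_hasFDerivAt]
  refine h.congr_fderiv ?_
  ext w
  simp [WithLp.prod_inner_apply, inner_add_left, inner_sub_left]
  ring

theorem norm_gradient_regularization_le {g : E → ℝ} (hg : Differentiable ℝ g) (p q : E) :
    ‖gradient (regularization g) (WithLp.toLp 2 (p, q))‖ ≤ ‖gradient g p‖ + 2 * ‖q - p‖ := by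
  rw [(hasGradientAt_regularization (z := WithLp.toLp 2 (p, q)) (hg p).hasGradientAt).gradient]
  refine (norm_toLp_two_le_add _ _).trans ?_
  change ‖gradient g p + (p - q)‖ + ‖q - p‖ ≤ _
  have := norm_add_le (gradient g p) (p - q)
  rw [norm_sub_rev p q] at this
  linarith

end Regularization

/-! ### Lyapunov analysis of the first-order system -/

section HeavyBall

variable {E : Type*} [NormedAddCommGroup E] [InnerProductSpace ℝ E]

/-- Dissipation estimate for the modified energy `g (x + θ w) + lam / 2 * ‖w‖ ^ 2` of the damped
inertial system with velocity `w`: here `D` is the gradient of `g` at the current position, `G` its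
gradient at the shifted one, and `W` is the acceleration. -/
theorem inner_add_inner_le_neg_mul_sq {w D G W : E} {lam gam θ κ κ₀ L : ℝ}
    (hlam : 0 < lam) (hθ : 0 < θ) (hθ1 : θ ≤ 1)
    (hκ : gam ≤ lam * κ) (hκ0 : 0 ≤ κ) (hκ1 : κ ≤ κ₀) (hL : 0 ≤ L)
    (hG : ‖G - D‖ ≤ L * (θ * ‖w‖)) (hW : W = -(κ • w) - lam⁻¹ • D)
    (hθ2 : θ * (L * (1 + κ₀) + lam * (κ₀ + L / lam) ^ 2 / 2) ≤ gam / 2) :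
    inner ℝ G (w + θ • W) + lam * inner ℝ w W ≤
      -(θ / (2 * lam) * ‖D‖ ^ 2 + gam / 2 * ‖w‖ ^ 2) := by
  obtain ⟨d, rfl⟩ : ∃ d, G = D + d := ⟨G - D, by abel⟩
  rw [add_sub_cancel_left] at hG
  -- The terms ⟨D, w⟩ of order zero in θ cancel; the shift supplies the good term -θ/lam ‖D‖².
  have hexp : inner ℝ (D + d) (w + θ • W) + lam * inner ℝ w W =
      -(θ * κ) * inner ℝ D w - θ / lam * ‖D‖ ^ 2 - lam * κ * ‖w‖ ^ 2
        + (1 - θ * κ) * inner ℝ d w - θ / lam * inner ℝ d D := by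
    rw [hW]
    simp only [inner_add_left, inner_add_right, inner_sub_right, inner_smul_right,
      inner_neg_right, real_inner_self_eq_norm_sq, real_inner_comm D w]
    field_simp
    ring
  rw [hexp]
  have hA := norm_nonneg w
  have hB := norm_nonneg D
  have hκ₀ : 0 ≤ κ₀ := hκ0.trans hκ1
  have hd : ∀ y : E, |inner ℝ d y| ≤ L * (θ * ‖w‖) * ‖y‖ := fun y =>
    (abs_real_inner_le_norm d y).trans (mul_le_mul_of_nonneg_right hG (norm_nonneg y))
  have h1 : -(θ * κ) * inner ℝ D w ≤ θ * κ₀ * (‖D‖ * ‖w‖) := by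
    have h := neg_le_of_abs_le (abs_real_inner_le_norm D w)
    have h2 : θ * κ * (‖D‖ * ‖w‖) ≤ θ * κ₀ * (‖D‖ * ‖w‖) := by gcongr
    have h3 := mul_le_mul_of_nonneg_left h (mul_nonneg hθ.le hκ0)
    linarith
  have h2 : (1 - θ * κ) * inner ℝ d w ≤ (1 + κ₀) * (L * (θ * ‖w‖) * ‖w‖) := by
    refine (le_abs_self _).trans ?_
    rw [abs_mul]
    refine mul_le_mul ?_ (hd w) (abs_nonneg _) (by positivity)
    have : θ * κ ≤ 1 * κ₀ := mul_le_mul hθ1 hκ1 hκ0 zero_le_one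
    have h0 : 0 ≤ θ * κ := by positivity
    exact abs_le.2 ⟨by linarith, by linarith⟩
  have h3 : -(θ / lam * inner ℝ d D) ≤ θ / lam * (L * ‖w‖ * ‖D‖) := by
    rw [← mul_neg]
    refine mul_le_mul_of_nonneg_left ?_ (by positivity)
    refine (neg_le_of_abs_le (hd D) |> neg_le.1).trans ?_
    have : θ * ‖w‖ ≤ ‖w‖ := mul_le_of_le_one_left hA hθ1
    gcongr
  have h4 : lam * κ * ‖w‖ ^ 2 ≥ gam * ‖w‖ ^ 2 := by gcongr
  -- Young's inequality, weighted so that the cross terms cost half of θ/lam ‖D‖²; by `hθ2` all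
  -- remaining errors cost at most half of the friction gam ‖w‖².
  have h5 : (κ₀ + L / lam) * (‖w‖ * ‖D‖) ≤
      ‖D‖ ^ 2 / (2 * lam) + lam * (κ₀ + L / lam) ^ 2 / 2 * ‖w‖ ^ 2 := by
    have h := sq_nonneg (‖D‖ - lam * (κ₀ + L / lam) * ‖w‖)
    have h' := div_nonneg h (by positivity : 0 ≤ 2 * lam)
    have : (‖D‖ - lam * (κ₀ + L / lam) * ‖w‖) ^ 2 / (2 * lam) =
      ‖D‖ ^ 2 / (2 * lam) + lam * (κ₀ + L / lam) ^ 2 / 2 * ‖w‖ ^ 2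
        - (κ₀ + L / lam) * (‖w‖ * ‖D‖) := by field_simp; ring
    linarith
  have h6 := mul_le_mul_of_nonneg_left h5 hθ.le
  have h7 := mul_le_mul_of_nonneg_right hθ2 (sq_nonneg ‖w‖)
  have h8 : θ / lam * ‖D‖ ^ 2 = 2 * (θ / (2 * lam) * ‖D‖ ^ 2) := by field_simp
  have h9 : θ * (‖D‖ ^ 2 / (2 * lam)) = θ / (2 * lam) * ‖D‖ ^ 2 := by ring
  have h10 : θ / lam * (L * ‖w‖ * ‖D‖) = θ * (L / lam * (‖w‖ * ‖D‖)) := by ring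
  nlinarith [h1, h2, h3, h4, h6, h7, h8, h9, h10]

/-- The solutions of a first-order form of the damped inertial gradient system have finite length
if the regularization of the potential is a KL function. -/
theorem exists_integrableOn_Ioi_of_isKLFunction [FiniteDimensional ℝ E] [CompleteSpace E]
    {g : E → ℝ} {L : NNReal} (hg : Differentiable ℝ g) (hL : LipschitzWith L (gradient g))
    (hbdd : BddBelow (range g)) (hH : IsKLFunction (regularization g))
    {lam gam κ₀ t₀ : ℝ} (hlam : 0 < lam) (hgam : 0 < gam) (ht₀ : 0 < t₀)
    {κ : ℝ → ℝ} (hκ : ∀ t, t₀ < t → gam ≤ lam * κ t) (hκ1 : ∀ t, t₀ < t → κ t ≤ κ₀)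
    {x w : ℝ → E} (hxb : Bornology.IsBounded (x '' Ici t₀))
    (hx : ∀ t, t₀ < t → HasDerivAt x (t • w t) t)
    (hw : ∀ t, t₀ < t →
      HasDerivAt w (t • (-(κ t • w t) - lam⁻¹ • gradient g (x t))) t) :
    ∃ T, t₀ < T ∧ IntegrableOn (fun t => t * (‖w t‖ + ‖gradient g (x t)‖)) (Ioi T) := by
  have hκ0 : ∀ t, t₀ < t → 0 < κ t := fun t ht =>
    pos_of_mul_pos_right (hgam.trans_le (hκ t ht)) hlam.le
  have hκ₀ : 0 < κ₀ := (hκ0 (t₀ + 1) (by linarith)).trans_le (hκ1 _ (by linarith))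
  have hL0 : (0 : ℝ) ≤ L := L.2
  set K : ℝ := L * (1 + κ₀) + lam * (κ₀ + L / lam) ^ 2 / 2 with hK
  have hKpos : 0 < K := by positivity
  obtain ⟨θ, hθ, hθ1, hθ2⟩ : ∃ θ : ℝ, 0 < θ ∧ θ ≤ 1 ∧ θ * K ≤ gam / 2 := by
    refine ⟨min 1 (gam / 2 / K), lt_min one_pos (by positivity), min_le_left _ _, ?_⟩
    rw [← le_div_iff₀ hKpos]
    exact min_le_right _ _
  -- The last factor 1/2 pays for (a + b)² ≤ 2(a² + b²).
  set c : ℝ := min (θ / (2 * lam)) (gam / 2) / 2 with hc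
  have hcpos : 0 < c := by positivity
  set W : ℝ → E := fun t => -(κ t • w t) - lam⁻¹ • gradient g (x t) with hW
  set p : ℝ → E := fun t => x t + θ • w t with hp
  -- With this scaling ½‖σ w‖² is the kinetic energy lam/2 ‖w‖².
  set σ : ℝ := √lam with hσ
  have hσ0 : 0 ≤ σ := Real.sqrt_nonneg _
  have hσ2 : σ ^ 2 = lam := Real.sq_sqrt hlam.le
  set δ : ℝ → ℝ := fun t => ‖w t‖ + ‖gradient g (x t)‖ with hδ
  have hδ0 : ∀ t, 0 ≤ δ t := fun t => by positivity
  have hAδ : ∀ t, ‖w t‖ ≤ δ t := fun t => le_add_of_nonneg_right (norm_nonneg _)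
  have hBδ : ∀ t, ‖gradient g (x t)‖ ≤ δ t := fun t => le_add_of_nonneg_left (norm_nonneg _)
  set z : ℝ → WithLp 2 (E × E) := fun t => WithLp.toLp 2 (p t, p t + σ • w t) with hz
  set z' : ℝ → WithLp 2 (E × E) := fun t =>
    WithLp.toLp 2 (t • (w t + θ • W t), t • (w t + θ • W t) + σ • (t • W t)) with hz'
  set e' : ℝ → ℝ := fun t =>
    t * (inner ℝ (gradient g (p t)) (w t + θ • W t) + lam * inner ℝ (w t) (W t)) with he'
  have hdp : ∀ t, t₀ < t → HasDerivAt p (t • (w t + θ • W t)) t := fun t ht => by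
    refine ((hx t ht).add ((hw t ht).const_smul θ)).congr_deriv ?_
    rw [smul_add, smul_comm θ t]
  have hdz : ∀ t, t₀ < t → HasDerivAt z (z' t) t := fun t ht =>
    ((WithLp.prodContinuousLinearEquiv 2 ℝ E E).symm.toContinuousLinearMap.hasFDerivAt
      (x := (p t, p t + σ • w t))).comp_hasDerivAt t
      ((hdp t ht).prodMk ((hdp t ht).add ((hw t ht).const_smul σ)))
  have hfz : ∀ t, regularization g (z t) = g (p t) + lam / 2 * ‖w t‖ ^ 2 := fun t => by
    change g (p t) + 1 / 2 * ‖p t - (p t + σ • w t)‖ ^ 2 = _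
    rw [sub_add_cancel_left, norm_neg, norm_smul, mul_pow, Real.norm_eq_abs, sq_abs, hσ2]
    ring
  have hde : ∀ t, t₀ < t → HasDerivAt (fun s => regularization g (z s)) (e' t) t := by
    intro t ht
    simp only [hfz]
    have h1 := ((hg (p t)).hasGradientAt.hasFDerivAt).comp_hasDerivAt t (hdp t ht)
    have h2 := ((hw t ht).norm_sq).const_mul (lam / 2)
    refine (h1.add h2).congr_deriv ?_
    simp only [InnerProductSpace.toDual_apply_apply, inner_smul_right, he']
    ring
  have hdiss : ∀ t, t₀ < t → c * (t * δ t) * δ t ≤ -e' t := by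
    intro t ht
    have ht' : 0 < t := ht₀.trans ht
    have hG : ‖gradient g (p t) - gradient g (x t)‖ ≤ L * (θ * ‖w t‖) := by
      refine (hL.norm_sub_le _ _).trans_eq ?_
      rw [hp, add_sub_cancel_left, norm_smul, Real.norm_of_nonneg hθ.le]
    have h := inner_add_inner_le_neg_mul_sq hlam hθ hθ1 (hκ t ht) (hκ0 t ht).le (hκ1 t ht) hL0
      hG (W := W t) rfl hθ2
    have h2 := mul_le_mul_of_nonneg_left h ht'.le
    have hm1 : 2 * c ≤ θ / (2 * lam) := by
      rw [hc, mul_div_cancel₀ _ two_ne_zero]; exact min_le_left _ _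
    have hm2 : 2 * c ≤ gam / 2 := by
      rw [hc, mul_div_cancel₀ _ two_ne_zero]; exact min_le_right _ _
    have h3 : c * δ t ^ 2 ≤
        θ / (2 * lam) * ‖gradient g (x t)‖ ^ 2 + gam / 2 * ‖w t‖ ^ 2 := by
      have ha := mul_le_mul_of_nonneg_right hm1 (sq_nonneg ‖gradient g (x t)‖)
      have hb := mul_le_mul_of_nonneg_right hm2 (sq_nonneg ‖w t‖)
      have hs := mul_le_mul_of_nonneg_left
        (add_sq_le (a := ‖w t‖) (b := ‖gradient g (x t)‖)) hcpos.le
      simp only [hδ]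
      linarith
    have h4 := mul_le_mul_of_nonneg_left h3 ht'.le
    simp only [he']
    linarith
  have hgrad : ∀ t, ‖gradient (regularization g) (z t)‖ ≤ (1 + L + 2 * σ) * δ t := by
    intro t
    refine (norm_gradient_regularization_le hg (p t) (p t + σ • w t)).trans ?_
    rw [add_sub_cancel_left, norm_smul, Real.norm_of_nonneg hσ0]
    have hG : ‖gradient g (p t)‖ ≤ ‖gradient g (x t)‖ + L * ‖w t‖ := by
      have h1 := hL.norm_sub_le (p t) (x t)
      rw [show p t - x t = θ • w t by simp [hp], norm_smul, Real.norm_of_nonneg hθ.le] at h1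
      have h2 : L * (θ * ‖w t‖) ≤ L * ‖w t‖ :=
        mul_le_mul_of_nonneg_left (mul_le_of_le_one_left (norm_nonneg _) hθ1) hL0
      have h3 := norm_le_norm_add_norm_sub' (gradient g (p t)) (gradient g (x t))
      linarith
    have h1 := mul_le_mul_of_nonneg_left (hAδ t) hL0
    have h2 := mul_le_mul_of_nonneg_left (hAδ t) hσ0
    have h3 := hBδ t
    linarith
  have hWδ : ∀ t, t₀ < t → ‖W t‖ ≤ (κ₀ + lam⁻¹) * δ t := by
    intro t ht
    refine (norm_sub_le _ _).trans ?_
    rw [norm_neg, norm_smul, norm_smul, Real.norm_of_nonneg (hκ0 t ht).le,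
      Real.norm_of_nonneg (inv_pos.2 hlam).le, add_mul]
    have hAδ := hAδ t
    have hBδ := hBδ t
    have hκ1 := hκ1 t ht
    gcongr
  have hz'le : ∀ t, t₀ < t →
      ‖z' t‖ ≤ (2 + (2 + σ) * (κ₀ + lam⁻¹)) * (t * δ t) := by
    intro t ht
    have ht' : 0 < t := ht₀.trans ht
    have h1 : ‖w t + θ • W t‖ ≤ (1 + (κ₀ + lam⁻¹)) * δ t := by
      refine (norm_add_le _ _).trans ?_
      rw [norm_smul, Real.norm_of_nonneg hθ.le]
      have h2 : θ * ‖W t‖ ≤ ‖W t‖ := mul_le_of_le_one_left (norm_nonneg _) hθ1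
      linarith [hAδ t, hWδ t ht]
    have h2 : ‖t • (w t + θ • W t)‖ ≤ t * ((1 + (κ₀ + lam⁻¹)) * δ t) := by
      rw [norm_smul, Real.norm_of_nonneg ht'.le]
      gcongr
    have h3 : ‖σ • (t • W t)‖ ≤ σ * (t * ((κ₀ + lam⁻¹) * δ t)) := by
      rw [norm_smul, norm_smul, Real.norm_of_nonneg ht'.le, Real.norm_of_nonneg hσ0]
      have := hWδ t ht
      gcongr
    refine (norm_toLp_two_le_add _ _).trans ?_
    have h4 := norm_add_le (t • (w t + θ • W t)) (σ • (t • W t))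
    linarith
  have hρ : ContinuousOn (fun t => t * δ t) (Ioi t₀) := by
    have hxc : ContinuousOn x (Ioi t₀) := fun t ht => (hx t ht).continuousAt.continuousWithinAt
    have hwc : ContinuousOn w (Ioi t₀) := fun t ht => (hw t ht).continuousAt.continuousWithinAt
    exact continuousOn_id.mul (hwc.norm.add (hL.continuous.comp_continuousOn hxc).norm)
  have hρ0 : ∀ t, t₀ < t → 0 ≤ t * δ t := fun t ht => mul_nonneg (ht₀.trans ht).le (hδ0 t)
  have hanti : AntitoneOn (fun s => regularization g (z s)) (Ioi t₀) := by
    refine antitoneOn_of_deriv_nonpos (convex_Ioi t₀)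
      (fun t ht => (hde t ht).continuousAt.continuousWithinAt)
      (fun t ht => (hde t (interior_subset ht)).differentiableAt.differentiableWithinAt) ?_
    intro t ht
    have ht' := interior_subset ht
    rw [(hde t ht').deriv]
    have h1 := hdiss t ht'
    have h2 : 0 ≤ c * (t * δ t) * δ t :=
      mul_nonneg (mul_nonneg hcpos.le (hρ0 t ht')) (hδ0 t)
    linarith
  obtain ⟨m, hm⟩ := hbdd
  obtain ⟨R, hR⟩ := hxb.exists_norm_le
  -- As g is bounded below, the decreasing energy bounds ‖w‖. The time t₀ + 1 is an arbitrary one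
  -- inside the open ray where the estimates hold.
  obtain ⟨Q, hQ⟩ : ∃ Q : ℝ, ∀ t, t₀ + 1 ≤ t → ‖w t‖ ≤ Q := by
    refine ⟨√(2 / lam * (regularization g (z (t₀ + 1)) - m)), fun t ht => Real.le_sqrt_of_sq_le ?_⟩
    have h1 := hanti (show t₀ < t₀ + 1 by linarith) (show t₀ < t by linarith) ht
    simp only at h1
    rw [hfz t] at h1
    have h2 : m ≤ g (p t) := hm (mem_range_self _)
    have h3 : lam / 2 * ‖w t‖ ^ 2 ≤ regularization g (z (t₀ + 1)) - m := by linarith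
    have h4 := mul_le_mul_of_nonneg_left h3 (by positivity : 0 ≤ 2 / lam)
    have h5 : 2 / lam * (lam / 2 * ‖w t‖ ^ 2) = ‖w t‖ ^ 2 := by field_simp
    linarith
  have hzb : ∀ t, t₀ + 1 ≤ t → ‖z t‖ ≤ 2 * (R + Q) + σ * Q := by
    intro t ht
    have hxR : ‖x t‖ ≤ R := hR _ (mem_image_of_mem _ (show t₀ ≤ t by linarith))
    have hpR : ‖p t‖ ≤ R + Q := by
      refine (norm_add_le _ _).trans ?_
      rw [norm_smul, Real.norm_of_nonneg hθ.le]
      have h2 : θ * ‖w t‖ ≤ ‖w t‖ := mul_le_of_le_one_left (norm_nonneg _) hθ1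
      linarith [hQ t ht]
    refine (norm_toLp_two_le_add _ _).trans ?_
    have h3 := norm_add_le (p t) (σ • w t)
    rw [norm_smul, Real.norm_of_nonneg hσ0] at h3
    have h4 := mul_le_mul_of_nonneg_left (hQ t ht) hσ0
    linarith
  have : FiniteDimensional ℝ (WithLp 2 (E × E)) :=
    (WithLp.linearEquiv 2 ℝ (E × E)).symm.finiteDimensional
  have : ProperSpace (WithLp 2 (E × E)) := FiniteDimensional.proper_real _
  obtain ⟨zbar, -, hzbar⟩ := (isCompact_closedBall (0 : WithLp 2 (E × E))
    (2 * (R + Q) + σ * Q)).exists_mapClusterPt (f := atTop) (u := z) (by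
      rw [le_principal_iff, mem_map]
      filter_upwards [eventually_ge_atTop (t₀ + 1)] with t ht
      exact mem_closedBall_zero_iff.2 (hzb t ht))
  refine (hH.2 zbar).exists_integrableOn_Ioi (c := c / (1 + L + 2 * σ))
    (C := 2 + (2 + σ) * (κ₀ + lam⁻¹)) hH.1.continuous hzbar hρ hρ0 (by positivity) (by positivity)
    hdz hz'le hde ?_ ?_
  · intro t ht
    refine le_trans ?_ (hdiss t ht)
    have h1 := mul_le_mul_of_nonneg_left (hgrad t)
      (mul_nonneg (div_pos hcpos (by positivity : 0 < 1 + L + 2 * σ)).le (hρ0 t ht))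
    refine h1.trans_eq ?_
    field_simp
  · intro t ht h0
    have h1 := hdiss t ht
    rw [h0, neg_zero] at h1
    have ht' : 0 < t := ht₀.trans ht
    have h2 : δ t = 0 := by
      by_contra hne
      have hpos : 0 < δ t := lt_of_le_of_ne (hδ0 t) (Ne.symm hne)
      have : 0 < c * (t * δ t) * δ t := by positivity
      linarith
    change t * δ t = 0
    rw [h2, mul_zero]

end HeavyBall

/-! ### Reduction of the equation to a first-order system -/

theorem LocallyAbsolutelyContinuous.continuousOn {E : Type*} [NormedAddCommGroup E] {t₀ : ℝ}
    {f : ℝ → E} (hf : LocallyAbsolutelyContinuous t₀ f) : ContinuousOn f (Ici t₀) := by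
  intro t ht
  have ht' : t₀ < t + 1 := by linarith [mem_Ici.1 ht]
  have h := (hf (t + 1) ht').uniformContinuousOn.continuousOn
  rw [uIcc_of_le ht'.le] at h
  refine (h t ⟨ht, by linarith⟩).mono_of_mem_nhdsWithin ?_
  rw [← Ici_inter_Iic]
  exact inter_mem self_mem_nhdsWithin (mem_nhdsWithin_of_mem_nhds (Iic_mem_nhds (by linarith)))

theorem hasDerivAt_curveDeriv {E : Type*} [NormedAddCommGroup E] [NormedSpace ℝ E] {t₀ t : ℝ}
    {f : ℝ → E} (hf : DifferentiableOn ℝ f (Ici t₀)) (ht : t₀ < t) :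
    HasDerivAt f (curveDeriv t₀ f t) t :=
  (hf t ht.le).hasDerivWithinAt.hasDerivAt (Ici_mem_nhds ht)

namespace IsStrongGlobalSolution

variable {E : Type*} [NormedAddCommGroup E] [InnerProductSpace ℝ E] [CompleteSpace E]
  {g : E → ℝ} {lam gam t₀ : ℝ} {u₀ v₀ : E} {x : ℝ → E}

/-- The equation holds at every time since all its terms are continuous. -/
theorem equation_of_lt (hx : IsStrongGlobalSolution g lam gam t₀ u₀ v₀ x)
    (hg : Continuous (gradient g)) (ht₀ : 0 < t₀) {t : ℝ} (ht : t₀ < t) :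
    (lam / t ^ 2) • curveDeriv t₀ (curveDeriv t₀ x) t + (gam / t) • curveDeriv t₀ x t
      + gradient g (x t) = 0 := by
  have hne : ∀ s ∈ Ioi t₀, s ≠ 0 := fun s hs => (ht₀.trans hs).ne'
  refine Measure.eqOn_open_of_ae_eq (μ := volume) (U := Ioi t₀)
    (f := fun t => (lam / t ^ 2) • curveDeriv t₀ (curveDeriv t₀ x) t
      + (gam / t) • curveDeriv t₀ x t + gradient g (x t)) (g := fun _ => (0 : E))
    (ae_restrict_of_ae_restrict_of_subset Ioi_subset_Ici_self hx.equation) isOpen_Ioi ?_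
    continuousOn_const ht
  have h1 : ContinuousOn (fun t : ℝ => lam / t ^ 2) (Ioi t₀) :=
    continuousOn_const.div (continuousOn_id.pow 2) fun s hs => pow_ne_zero 2 (hne s hs)
  have h2 : ContinuousOn (fun t : ℝ => gam / t) (Ioi t₀) :=
    continuousOn_const.div continuousOn_id hne
  exact ((h1.smul (hx.locAC_deriv_deriv.continuousOn.mono Ioi_subset_Ici_self)).add
    (h2.smul (hx.locAC_deriv.continuousOn.mono Ioi_subset_Ici_self))).add
    (hg.comp_continuousOn (hx.locAC.continuousOn.mono Ioi_subset_Ici_self))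

theorem inv_smul_curveDeriv_curveDeriv (hx : IsStrongGlobalSolution g lam gam t₀ u₀ v₀ x)
    (hg : Continuous (gradient g)) (hlam : 0 < lam) (ht₀ : 0 < t₀) {t : ℝ} (ht : t₀ < t) :
    t⁻¹ • curveDeriv t₀ (curveDeriv t₀ x) t =
      -((gam / lam) • curveDeriv t₀ x t) - (t / lam) • gradient g (x t) := by
  have ht' : t ≠ 0 := (ht₀.trans ht).ne'
  have h := congrArg (fun y => (t / lam) • y) (hx.equation_of_lt hg ht₀ ht)
  simp only [smul_add, smul_smul, smul_zero] at h
  have e1 : t / lam * (lam / t ^ 2) = t⁻¹ := by field_simp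
  have e2 : t / lam * (gam / t) = gam / lam := by field_simp
  rw [e1, e2] at h
  rw [eq_sub_iff_add_eq, eq_neg_iff_add_eq_zero, ← h]
  abel

/-- In terms of `w t = x' t / t` the equation becomes a first-order system. -/
theorem hasDerivAt_inv_smul_curveDeriv (hx : IsStrongGlobalSolution g lam gam t₀ u₀ v₀ x)
    (hg : Continuous (gradient g)) (hlam : 0 < lam) (ht₀ : 0 < t₀) {t : ℝ} (ht : t₀ < t) :
    HasDerivAt (fun s => s⁻¹ • curveDeriv t₀ x s)
      (t • (-((gam / lam + (t ^ 2)⁻¹) • (t⁻¹ • curveDeriv t₀ x t))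
        - lam⁻¹ • gradient g (x t))) t := by
  have ht' : t ≠ 0 := (ht₀.trans ht).ne'
  refine ((hasDerivAt_inv ht').smul
    (hasDerivAt_curveDeriv hx.differentiableOn_deriv ht)).congr_deriv ?_
  rw [hx.inv_smul_curveDeriv_curveDeriv hg hlam ht₀ ht]
  -- Differentiating the factor 1/t gives -x'/t², which is the term 1/t² in the damping.
  match_scalars <;> field_simp
  ring

end IsStrongGlobalSolution

/-! ### Integrability and convergence of the solution -/

theorem integrableOn_Ici_of_norm_le {E : Type*} [NormedAddCommGroup E] {f : ℝ → E} {ρ : ℝ → ℝ}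
    {t₀ T : ℝ} (hT : t₀ ≤ T) (hf : ContinuousOn f (Ici t₀)) (hρ : IntegrableOn ρ (Ioi T))
    (hle : ∀ t, T < t → ‖f t‖ ≤ ρ t) : IntegrableOn f (Ici t₀) := by
  rw [← Icc_union_Ioi_eq_Ici hT]
  refine ((hf.mono Icc_subset_Ici_self).integrableOn_Icc).union (Integrable.mono' hρ ?_ ?_)
  · exact (hf.mono fun t (ht : T < t) => hT.trans ht.le).aestronglyMeasurable measurableSet_Ioi
  · exact (ae_restrict_mem measurableSet_Ioi).mono hle

theorem theorem4p3 (n : ℕ) (g : EuclideanSpace ℝ (Fin n) → ℝ) (L : NNReal)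
    (hg : Differentiable ℝ g) (hL : LipschitzWith L (gradient g))
    (hbdd : BddBelow (range g))
    (lam gam t₀ : ℝ) (hlam : 0 < lam) (hgam : 0 < gam) (ht₀ : 0 < t₀)
    (u₀ v₀ : EuclideanSpace ℝ (Fin n)) (x : ℝ → EuclideanSpace ℝ (Fin n))
    (hx : IsStrongGlobalSolution g lam gam t₀ u₀ v₀ x)
    (hxb : Bornology.IsBounded (x '' Ici t₀))
    (hH : IsKLFunction (regularization g)) :
    IntegrableOn (curveDeriv t₀ x) (Ici t₀) ∧
    IntegrableOn (fun t : ℝ => (1 / t) • curveDeriv t₀ (curveDeriv t₀ x) t) (Ici t₀) ∧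
    ∃ xbar ∈ crit g, Tendsto x atTop (𝓝 xbar) := by
  have hgc := hL.continuous
  have hxd : ∀ t, t₀ < t → HasDerivAt x (curveDeriv t₀ x t) t := fun t ht =>
    hasDerivAt_curveDeriv hx.differentiableOn ht
  obtain ⟨T, hT, hρ⟩ := exists_integrableOn_Ioi_of_isKLFunction hg hL hbdd hH hlam hgam ht₀
    (κ := fun t => gam / lam + (t ^ 2)⁻¹) (κ₀ := gam / lam + (t₀ ^ 2)⁻¹)
    (w := fun s => s⁻¹ • curveDeriv t₀ x s)
    (fun t ht => by
      have : 0 ≤ lam * (t ^ 2)⁻¹ := by positivity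
      rw [mul_add, mul_div_cancel₀ _ hlam.ne']
      linarith)
    (fun t ht => by gcongr) hxb
    (fun t ht => (hxd t ht).congr_deriv (smul_inv_smul₀ (ht₀.trans ht).ne' _).symm)
    (fun t ht => hx.hasDerivAt_inv_smul_curveDeriv hgc hlam ht₀ ht)
  set ρ : ℝ → ℝ := fun t => t * (‖t⁻¹ • curveDeriv t₀ x t‖ + ‖gradient g (x t)‖) with hρdef
  have hρ_eq : ∀ t, t₀ < t → ρ t = ‖curveDeriv t₀ x t‖ + t * ‖gradient g (x t)‖ := by
    intro t ht
    have ht' : 0 < t := ht₀.trans ht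
    rw [hρdef]
    simp only [norm_smul, norm_inv, Real.norm_of_nonneg ht'.le, mul_add]
    rw [mul_inv_cancel_left₀ ht'.ne']
  have hvle : ∀ t, T < t → ‖curveDeriv t₀ x t‖ ≤ ρ t := fun t ht => by
    rw [hρ_eq t (hT.trans ht)]
    exact le_add_of_nonneg_right (mul_nonneg (ht₀.trans (hT.trans ht)).le (norm_nonneg _))
  have hgle : ∀ t, T < t → t * ‖gradient g (x t)‖ ≤ ρ t := fun t ht => by
    rw [hρ_eq t (hT.trans ht)]
    exact le_add_of_nonneg_left (norm_nonneg _)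
  have hv := integrableOn_Ici_of_norm_le hT.le hx.locAC_deriv.continuousOn hρ hvle
  refine ⟨hv, ?_, ?_⟩
  · refine integrableOn_Ici_of_norm_le hT.le ?_ (hρ.const_mul (gam / lam + 1 / lam)) ?_
    · exact (continuousOn_const.div continuousOn_id
        fun s (hs : t₀ ≤ s) => (ht₀.trans_le hs).ne').smul hx.locAC_deriv_deriv.continuousOn
    · intro t ht
      have ht' : 0 < t := ht₀.trans (hT.trans ht)
      rw [one_div t, hx.inv_smul_curveDeriv_curveDeriv hgc hlam ht₀ (hT.trans ht)]
      refine (norm_sub_le _ _).trans ?_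
      rw [norm_neg, norm_smul, norm_smul, Real.norm_of_nonneg (by positivity),
        Real.norm_of_nonneg (by positivity), add_mul]
      have h1 := mul_le_mul_of_nonneg_left (hvle t ht) (by positivity : 0 ≤ gam / lam)
      have h2 := mul_le_mul_of_nonneg_left (hgle t ht) (by positivity : 0 ≤ 1 / lam)
      have h3 : t / lam * ‖gradient g (x t)‖ = 1 / lam * (t * ‖gradient g (x t)‖) := by ring
      linarith
  · have hlim : Tendsto x atTop (𝓝 (limUnder atTop x)) :=
      tendsto_limUnder_of_hasDerivAt_of_integrableOn_Ioi (a := t₀) (fun t ht => hxd t ht)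
        (hv.mono_set Ioi_subset_Ici_self)
    refine ⟨_, ?_, hlim⟩
    -- Otherwise t ‖∇g(x)‖ ≤ ρ would eventually exceed a positive constant, contradicting
    -- integrability on a ray of infinite length.
    by_contra hne
    have hpos : 0 < ‖gradient g (limUnder atTop x)‖ := norm_pos_iff.2 hne
    have hev : ∀ᶠ t in atTop,
        ‖gradient g (limUnder atTop x)‖ / 2 < ‖gradient g (x t)‖ :=
      ((hgc.tendsto _).comp hlim).norm.eventually (lt_mem_nhds (half_lt_self hpos))
    obtain ⟨S, hS⟩ := eventually_atTop.1 hev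
    have hmem : ∀ t ∈ Ioi (max S T),
        ‖t₀ * (‖gradient g (limUnder atTop x)‖ / 2)‖ ≤ ρ t := by
      intro t ht
      have htT : T < t := (le_max_right S T).trans_lt ht
      rw [Real.norm_of_nonneg (by positivity)]
      refine le_trans ?_ (hgle t htT)
      have h1 := (hS t ((le_max_left S T).trans ht.le)).le
      have h2 : t₀ ≤ t := (hT.trans htT).le
      have h3 : 0 ≤ t := ht₀.le.trans h2
      gcongr
    have hint : IntegrableOn (fun _ : ℝ => t₀ * (‖gradient g (limUnder atTop x)‖ / 2))
        (Ioi (max S T)) :=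
      Integrable.mono' (hρ.mono_set (Ioi_subset_Ioi (le_max_right S T)))
        aestronglyMeasurable_const ((ae_restrict_mem measurableSet_Ioi).mono hmem)
    rw [integrableOn_const_iff, Real.volume_Ioi] at hint
    rcases hint with h | h
    · exact (by positivity : t₀ * (‖gradient g (limUnder atTop x)‖ / 2) ≠ 0)
        (enorm_eq_zero.1 h)
    · exact absurd h (lt_irrefl _)
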